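/- For complex-valued measurable functions $f,g$ on $(0,\infty)$ and $y>0$ let $$\mathscr H_\nu\{f(x);y\}=\int_0^\infty\sqrt{xy}\,J_\nu(xy)f(x)\,dx,\qquad \mathscr K_\nu\{f(x);y\}=\int_0^\infty\sqrt{xy}\,K_\nu(xy)f(x)\,dx,\qquad \mathscr P\{f(x);y\}=\int_0^\infty\frac{x\,f(x)}{x^2+y^2}\,dx$$ be the Hankel transform, the $\mathscr K$-transform and the Widder potential transform, where $J_\nu$ is the Bessel function of the first kind and $K_\nu$ the modified Bessel function of the second kind (Macdonald function). Let $\nu\in\mathbb C$ with $\operatorname{Re}\nu>-1$. Then $$\int_0^\infty \mathscr H_\nu\{f(x);y\}\,\mathscr K_\nu\{g(u);y\}\,dy=\int_0^\infty x^{\nu+1/2}f(x)\,\mathscr P\{u^{-\nu-1/2}g(u);x\}\,dx,\tag{1}$$ $$\int_0^\infty \mathscr H_\nu\{f(x);y\}\,\mathscr K_\nu\{g(u);y\}\,dy=\int_0^\infty u^{-\nu+1/2}g(u)\,\mathscr P\{x^{\nu-1/2}f(x);u\}\,du,\tag{2}$$ $$\int_0^\infty x^{\nu+1/2}f(x)\,\mathscr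 P\{u^{-\nu-1/2}g(u);x\}\,dx=\int_0^\infty u^{-\nu+1/2}g(u)\,\mathscr P\{x^{\nu-1/2}f(x);u\}\,du,\tag{3}$$ provided that the integrals involved converge absolutely as iterated integrals. That is, (1) and (2) hold whenever $$\int_0^\infty\!\int_0^\infty\!\int_0^\infty\bigl|\sqrt{xy}\,J_\nu(xy)f(x)\,\sqrt{uy}\,K_\nu(uy)g(u)\bigr|\,dx\,du\,dy<\infty,$$ and (3) holds whenever $$\int_0^\infty\!\int_0^\infty\Bigl|\frac{x^{\nu+1/2}u^{-\nu+1/2}f(x)g(u)}{x^2+u^2}\Bigr|\,dx\,du<\infty.$$ -/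

import Mathlib

open MeasureTheory Set

noncomputable section

/-- The Bessel function of the first kind `J_ν(z)`, by its power series
`(z/2)^ν ∑ (-1)^k / (k! Γ(ν+k+1)) (z/2)^{2k}`. Mathlib's `Gamma` is `0` at its poles, so the
coefficient `1/Γ` has there its correct value `0`. -/
def besselJ (ν z : ℂ) : ℂ :=
  (z / 2) ^ ν *
    ∑' k : ℕ, (-1 : ℂ) ^ k / ((k.factorial : ℂ) * Complex.Gamma (ν + k + 1)) * (z / 2) ^ (2 * k)

/-- The modified Bessel function of the second kind (Macdonald function)
`K_ν(z) = ∫₀^∞ exp(-z cosh t) cosh(ν t) dt`, for `Re z > 0` and every complex order `ν`. -/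
def besselK (ν z : ℂ) : ℂ :=
  ∫ t in Ioi (0 : ℝ), Complex.exp (-z * Complex.cosh (t : ℂ)) * Complex.cosh (ν * (t : ℂ))

/-- The integrand `√(x y) J_ν(x y) f(x)` of the Hankel transform. -/
def hankelIntegrand (ν : ℂ) (f : ℝ → ℂ) (y x : ℝ) : ℂ :=
  (Real.sqrt (x * y) : ℂ) * besselJ ν ((x * y : ℝ) : ℂ) * f x

/-- The Hankel transform `H_ν{f(x); y} = ∫₀^∞ √(x y) J_ν(x y) f(x) dx`. -/
def hankelTransform (ν : ℂ) (f : ℝ → ℂ) (y : ℝ) : ℂ :=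
  ∫ x in Ioi (0 : ℝ), hankelIntegrand ν f y x

/-- The integrand `√(x y) K_ν(x y) f(x)` of the `K`-transform. -/
def kIntegrand (ν : ℂ) (f : ℝ → ℂ) (y x : ℝ) : ℂ :=
  (Real.sqrt (x * y) : ℂ) * besselK ν ((x * y : ℝ) : ℂ) * f x

/-- The `K`-transform `K_ν{f(x); y} = ∫₀^∞ √(x y) K_ν(x y) f(x) dx`. -/
def kTransform (ν : ℂ) (f : ℝ → ℂ) (y : ℝ) : ℂ :=
  ∫ x in Ioi (0 : ℝ), kIntegrand ν f y x

/-- The integrand `x f(x) / (x² + y²)` of the Widder potential transform. -/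
def widderIntegrand (f : ℝ → ℂ) (y x : ℝ) : ℂ :=
  (x : ℂ) * f x / ((x : ℂ) ^ 2 + (y : ℂ) ^ 2)

/-- The Widder potential transform `P{f(x); y} = ∫₀^∞ x f(x) / (x² + y²) dx`. -/
def widderTransform (f : ℝ → ℂ) (y : ℝ) : ℂ :=
  ∫ x in Ioi (0 : ℝ), widderIntegrand f y x

end

/-!
All three identities come from one integral,
`∫₀^∞ y J_ν(xy) K_ν(uy) dy = (x/u)^ν / (x² + u²)` for `x, u > 0` and `Re ν > -1`
(`integral_besselJ_mul_besselK`). Given it, Fubini's theorem turns the integral of the product of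
the two transforms into the double integral of
`x^{ν+1/2} u^{-ν+1/2} f(x) g(u) / (x² + u²)` over the quadrant, and the two orders of integration
there are the two right-hand sides.

For the kernel integral, the substitution `τ = (u/2y) e^t` in the definition of `K_ν` gives
`2 (u/2y)^ν K_ν(uy) = ∫₀^∞ τ^{ν-1} exp(-τ y² - u²/(4τ)) dτ`
(`integral_cpow_mul_exp_eq_besselK`), while integrating the power series of `J_ν` termwise against
a Gaussian gives Weber's integral, which in terms of the series `S_ν` in `J_ν(z) = (z/2)^ν S_ν(z)`
reads `∫₀^∞ y^{2ν+1} S_ν(xy) exp(-ρ y²) dy = ½ ρ^{-ν-1} exp(-x²/(4ρ))`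
(`weber_integral_besselSeries`). Exchanging the `y`- and the `τ`-integral leaves
`∫₀^∞ τ^{-2} exp(-(x² + u²)/(4τ)) dτ = 4 / (x² + u²)`.

That exchange is not covered by the absolute form of Weber's bound, which has `exp(+x²/(4ρ))`. It
becomes legitimate after a factor `exp(-ε y²)` is inserted, which replaces `ρ = τ` by
`ρ = ε + τ ≥ ε` and makes the bad factor at most `exp(x²/(4ε))`. The factor is removed by letting
`ε → 0`, with dominated convergence on both sides. On the side of the Bessel functions the
domination is the integrability of `y J_ν(xy) K_ν(uy)`, and for almost all `(x, u)` with
`f(x) g(u) ≠ 0` this is part of the absolute convergence of the triple integral. No asymptotic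
estimate of `J_ν` is needed.
-/

/-! ### Moments of Gaussians and of `exp (-c / t)` -/

theorem integral_norm_cpow_mul_exp_neg_mul_sq {s : ℂ} (hs : 0 < s.re) {ρ : ℝ} (hρ : 0 < ρ) :
    ∫ y in Ioi (0 : ℝ), ‖(y : ℂ) ^ (2 * s - 1) * Complex.exp (-(ρ * y ^ 2))‖ =
      1 / 2 * ρ ^ (-s.re) * Real.Gamma s.re := by
  have h := integral_rpow_mul_exp_neg_mul_rpow (p := 2) (q := 2 * s.re - 1) two_pos
    (by linarith) hρ
  have e : (2 * s.re - 1 + 1) / 2 = s.re := by ring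
  rw [neg_div, e] at h
  rw [show 1 / 2 * ρ ^ (-s.re) * Real.Gamma s.re = ρ ^ (-s.re) * (1 / 2) * Real.Gamma s.re by ring,
    ← h]
  refine setIntegral_congr_fun measurableSet_Ioi fun y hy => ?_
  simp only [norm_mul, Complex.norm_cpow_eq_rpow_re_of_pos hy, Complex.norm_exp]
  norm_cast
  simp

theorem integrableOn_cpow_mul_exp_neg_mul_sq {s : ℂ} (hs : 0 < s.re) {ρ : ℝ} (hρ : 0 < ρ) :
    IntegrableOn (fun y : ℝ => (y : ℂ) ^ (2 * s - 1) * Complex.exp (-(ρ * y ^ 2))) (Ioi 0) := by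
  refine (integrableOn_rpow_mul_exp_neg_mul_sq hρ (s := 2 * s.re - 1) (by linarith)).mono' ?_ ?_
  · refine ContinuousOn.aestronglyMeasurable (fun y hy => ?_) measurableSet_Ioi
    refine ContinuousAt.continuousWithinAt (ContinuousAt.mul ?_ (by fun_prop))
    exact Complex.continuousAt_ofReal_cpow_const _ _ (Or.inr (ne_of_gt hy))
  · refine (ae_restrict_iff' measurableSet_Ioi).2 (.of_forall fun y hy => le_of_eq ?_)
    simp only [norm_mul, Complex.norm_cpow_eq_rpow_re_of_pos hy, Complex.norm_exp]
    norm_cast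
    simp

theorem integral_cpow_mul_exp_neg_mul_sq {s : ℂ} (hs : 0 < s.re) {ρ : ℝ} (hρ : 0 < ρ) :
    ∫ y in Ioi (0 : ℝ), (y : ℂ) ^ (2 * s - 1) * Complex.exp (-(ρ * y ^ 2)) =
      1 / 2 * (ρ : ℂ) ^ (-s) * Complex.Gamma s := by
  have h := mellin_comp_rpow (fun t : ℝ => Complex.exp (-(ρ * t))) (2 * s) 2
  have e : 2 * s / ((2 : ℝ) : ℂ) = s := by push_cast; field_simp
  rw [e, mellin, mellin] at h
  simp only [smul_eq_mul, Complex.integral_cpow_mul_exp_neg_mul_Ioi hs hρ] at h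
  have e2 : (1 / (ρ : ℂ)) ^ s = (ρ : ℂ) ^ (-s) := by
    rw [one_div, Complex.inv_cpow _ _ (by
      rw [Complex.arg_ofReal_of_nonneg hρ.le]; exact Real.pi_pos.ne), Complex.cpow_neg]
  rw [e2] at h
  simpa [mul_assoc] using h

theorem integrableOn_cpow_neg_two_mul_exp_neg_div {c : ℝ} (hc : 0 < c) :
    IntegrableOn (fun t : ℝ => (t : ℂ) ^ (-2 : ℂ) * Complex.exp (-(c / t))) (Ioi 0) := by
  have h := (MellinConvergent.comp_rpow (f := fun t : ℝ => Complex.exp (-(c * t)))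
    (s := -1) (a := -1) (by norm_num)).2 (by
      have h1 : IntegrableOn (fun t : ℝ => ((Real.exp (-c * t) : ℝ) : ℂ)) (Ioi 0) :=
        (exp_neg_integrableOn_Ioi 0 hc).ofReal
      simpa [MellinConvergent] using h1)
  refine h.congr_fun (fun t ht => ?_) measurableSet_Ioi
  simp only [smul_eq_mul, Real.rpow_neg_one]
  norm_num [div_eq_mul_inv]

theorem integral_cpow_neg_two_mul_exp_neg_div {c : ℝ} (hc : 0 < c) :
    ∫ t in Ioi (0 : ℝ), (t : ℂ) ^ (-2 : ℂ) * Complex.exp (-(c / t)) = 1 / c := by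
  have h := mellin_comp_rpow (fun t : ℝ => Complex.exp (-(c * t))) (-1) (-1)
  have h1 := Complex.integral_cpow_mul_exp_neg_mul_Ioi (a := 1) (by simp) hc
  have e : (-1 : ℂ) / ((-1 : ℝ) : ℂ) = 1 := by norm_num
  rw [e, mellin, mellin] at h
  simp only [smul_eq_mul, h1] at h
  simp only [Complex.cpow_one, Complex.Gamma_one, mul_one, abs_neg, abs_one, inv_one, one_smul] at h
  rw [← h]
  refine setIntegral_congr_fun measurableSet_Ioi fun t ht => ?_
  simp only [Real.rpow_neg_one]
  norm_num [div_eq_mul_inv]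

/-- Near `0` the factor `exp (-(b / t)) ≤ t / b` gains one power of `t`, so `-1 < s.re` suffices. -/
theorem integrableOn_cpow_mul_exp_neg_mul_sub_div {s : ℂ} (hs : -1 < s.re) {a b : ℝ} (ha : 0 < a)
    (hb : 0 < b) :
    IntegrableOn (fun t : ℝ => (t : ℂ) ^ (s - 1) * Complex.exp (-(a * t) - b / t)) (Ioi 0) := by
  have h := (integrableOn_rpow_mul_exp_neg_mul_rpow (p := 1) (s := s.re) hs one_pos ha).const_mul
    (1 / b)
  refine h.mono' ?_ ?_
  · refine ContinuousOn.aestronglyMeasurable (fun y hy => ?_) measurableSet_Ioi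
    have hy' : (y : ℂ) ≠ 0 := by exact_mod_cast (ne_of_gt hy)
    refine ContinuousAt.continuousWithinAt (ContinuousAt.mul ?_ (by fun_prop (disch := assumption)))
    exact Complex.continuousAt_ofReal_cpow_const _ _ (Or.inr (ne_of_gt hy))
  · refine (ae_restrict_iff' measurableSet_Ioi).2 (.of_forall fun t ht => ?_)
    have ht : 0 < t := ht
    simp only [norm_mul, Complex.norm_cpow_eq_rpow_re_of_pos ht, Complex.norm_exp]
    norm_cast
    rw [pow_one, sub_eq_add_neg (-(a * t)), Real.exp_add, Complex.sub_re, Complex.one_re,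
      Real.rpow_sub_one ht.ne']
    have h1 : Real.exp (-(b / t)) ≤ t / b := by
      rw [Real.exp_neg, inv_le_comm₀ (Real.exp_pos _) (by positivity), inv_div]
      linarith [Real.add_one_le_exp (b / t)]
    calc t ^ s.re / t * (Real.exp (-(a * t)) * Real.exp (-(b / t)))
        ≤ t ^ s.re / t * (Real.exp (-(a * t)) * (t / b)) := by gcongr
      _ = _ := by rw [neg_mul]; field_simp

/-! ### The Macdonald function as a Gaussian superposition -/

theorem image_mul_exp_univ {a : ℝ} (ha : 0 < a) :
    (fun t => a * Real.exp t) '' univ = Ioi 0 := by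
  ext τ
  simp only [image_univ, mem_range, mem_Ioi]
  refine ⟨?_, fun h => ⟨Real.log (τ / a), ?_⟩⟩
  · rintro ⟨t, rfl⟩; positivity
  · rw [Real.exp_log (by positivity)]; field_simp

theorem injOn_mul_exp_univ {a : ℝ} (ha : 0 < a) : InjOn (fun t => a * Real.exp t) univ :=
  fun _ _ _ _ h => Real.exp_injective (mul_left_cancel₀ ha.ne' h)

theorem hasDerivWithinAt_mul_exp (a t : ℝ) :
    HasDerivWithinAt (fun t => a * Real.exp t) (a * Real.exp t) univ t :=
  ((Real.hasDerivAt_exp t).const_mul a).hasDerivWithinAt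

theorem integral_Ioi_zero_eq_integral_mul_exp (g : ℝ → ℂ) {a : ℝ} (ha : 0 < a) :
    ∫ τ in Ioi (0 : ℝ), g τ = ∫ t : ℝ, (a * Real.exp t) • g (a * Real.exp t) := by
  have h := integral_image_eq_integral_abs_deriv_smul MeasurableSet.univ
    (fun t _ => hasDerivWithinAt_mul_exp a t) (injOn_mul_exp_univ ha) g
  rw [image_mul_exp_univ ha, Measure.restrict_univ] at h
  rw [h]
  congr! 2 with t
  rw [abs_of_pos (by positivity)]

theorem integrableOn_Ioi_zero_iff_integrable_mul_exp (g : ℝ → ℂ) {a : ℝ} (ha : 0 < a) :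
    IntegrableOn g (Ioi 0) ↔ Integrable fun t : ℝ => (a * Real.exp t) • g (a * Real.exp t) := by
  have h := integrableOn_image_iff_integrableOn_abs_deriv_smul MeasurableSet.univ
    (fun t _ => hasDerivWithinAt_mul_exp a t) (injOn_mul_exp_univ ha) g
  rw [image_mul_exp_univ ha, integrableOn_univ] at h
  rw [h]
  congr! 3 with t
  rw [abs_of_pos (by positivity)]

/-- The integral over the half-line of the even part of a function is half its integral over `ℝ`. -/
theorem integral_Ioi_zero_half_add_neg {F : ℝ → ℂ} (hF : Integrable F) :
    ∫ t in Ioi (0 : ℝ), (F t + F (-t)) / 2 = (∫ t, F t) / 2 := by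
  rw [integral_div, integral_add hF.integrableOn hF.comp_neg.integrableOn,
    integral_comp_neg_Ioi, neg_zero, add_comm,
    intervalIntegral.integral_Iic_add_Ioi hF.integrableOn hF.integrableOn]

/-- The representation of `K_ν` as a superposition of Gaussians `exp (-(y ^ 2 * τ))`, obtained from
`τ = u / (2 * y) * exp t`. -/
theorem integral_cpow_mul_exp_eq_besselK {ν : ℂ} (hν : -1 < ν.re) {u y : ℝ} (hu : 0 < u)
    (hy : 0 < y) :
    ∫ τ in Ioi (0 : ℝ), (τ : ℂ) ^ (ν - 1) *
        Complex.exp (-((y ^ 2 : ℝ) * τ) - (u ^ 2 / 4 : ℝ) / τ) =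
      2 * ((u / (2 * y) : ℝ) : ℂ) ^ ν * besselK ν ((u * y : ℝ) : ℂ) := by
  have ha : 0 < u / (2 * y) := by positivity
  set a := u / (2 * y) with ha_def
  let F : ℝ → ℂ := fun t =>
    Complex.exp (-((u * y : ℝ) : ℂ) * Complex.cosh t) * Complex.exp (ν * t)
  have hg := integrableOn_cpow_mul_exp_neg_mul_sub_div hν (a := y ^ 2) (b := u ^ 2 / 4)
    (by positivity) (by positivity)
  have key : (fun t : ℝ => (a * Real.exp t) • (((a * Real.exp t : ℝ) : ℂ) ^ (ν - 1) *
      Complex.exp (-((y ^ 2 : ℝ) * (a * Real.exp t : ℝ)) -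
        (u ^ 2 / 4 : ℝ) / (a * Real.exp t : ℝ)))) = fun t => (a : ℂ) ^ ν * F t := by
    funext t
    have h0 : ((a * Real.exp t : ℝ) : ℂ) ≠ 0 := by
      exact_mod_cast (by positivity : a * Real.exp t ≠ 0)
    rw [Complex.real_smul, ← mul_assoc, Complex.cpow_sub _ _ h0, Complex.cpow_one,
      mul_div_cancel₀ _ h0, Complex.ofReal_mul, Complex.mul_cpow_ofReal_nonneg ha.le
      (Real.exp_pos t).le, mul_assoc]
    congr 1
    rw [mul_comm]
    refine congrArg₂ _ ?_ ?_
    · rw [Complex.cosh, ha_def, Complex.exp_neg]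
      congr 1
      push_cast
      have : Complex.exp t ≠ 0 := Complex.exp_ne_zero _
      have : (u : ℂ) ≠ 0 := by exact_mod_cast hu.ne'
      have : (y : ℂ) ≠ 0 := by exact_mod_cast hy.ne'
      field_simp
      ring
    · rw [Complex.ofReal_exp, Complex.cpow_def_of_ne_zero (Complex.exp_ne_zero _),
        ← Complex.ofReal_exp, ← Complex.ofReal_log (Real.exp_pos t).le, Real.log_exp, mul_comm]
  have ha0 : (a : ℂ) ^ ν ≠ 0 := by
    rw [Complex.cpow_ne_zero_iff]
    exact Or.inl (by exact_mod_cast ha.ne')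
  have hF : Integrable F := by
    rw [integrableOn_Ioi_zero_iff_integrable_mul_exp _ ha, key] at hg
    simpa [ha0] using hg.const_mul ((a : ℂ) ^ ν)⁻¹
  rw [integral_Ioi_zero_eq_integral_mul_exp _ ha, key, integral_const_mul,
    mul_comm 2, mul_assoc, eq_comm]
  congr 1
  rw [besselK, mul_comm, ← eq_div_iff two_ne_zero, ← integral_Ioi_zero_half_add_neg hF]
  refine setIntegral_congr_fun measurableSet_Ioi fun t _ => ?_
  have hcosh : Complex.cosh (ν * t) =
      (Complex.exp (ν * t) + Complex.exp (-(ν * t))) / 2 := rfl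
  simp only [F, Complex.ofReal_neg, Complex.cosh_neg, mul_neg, hcosh]
  ring

/-! ### Termwise integration and Weber's integral -/

/-- A series of integrable functions with summable `L¹` norms that converges almost everywhere has an
integrable sum, whose `L¹` norm is at most the sum of the `L¹` norms. -/
theorem integrable_tsum_and_integral_norm_tsum_le {α : Type*} [MeasurableSpace α] {μ : Measure α}
    {F : ℕ → α → ℂ} (hF : ∀ k, Integrable (F k) μ) (hsum : Summable fun k => ∫ a, ‖F k a‖ ∂μ)
    (hs : ∀ᵐ a ∂μ, Summable fun k => F k a) :
    Integrable (fun a => ∑' k, F k a) μ ∧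
      ∫ a, ‖∑' k, F k a‖ ∂μ ≤ ∑' k, ∫ a, ‖F k a‖ ∂μ := by
  have hm : AEStronglyMeasurable (fun a => ∑' k, F k a) μ := by
    refine aestronglyMeasurable_of_tendsto_ae Filter.atTop
      (f := fun (n : ℕ) a => ∑ k ∈ Finset.range n, F k a) (fun n => ?_) ?_
    · exact (integrable_finsetSum _ fun k _ => hF k).aestronglyMeasurable
    · filter_upwards [hs] with a ha using ha.hasSum.tendsto_sum_nat
  have hle : ∫⁻ a, ‖∑' k, F k a‖ₑ ∂μ ≤ ENNReal.ofReal (∑' k, ∫ a, ‖F k a‖ ∂μ) := by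
    calc ∫⁻ a, ‖∑' k, F k a‖ₑ ∂μ ≤ ∫⁻ a, ∑' k, ‖F k a‖ₑ ∂μ :=
          lintegral_mono fun a => enorm_tsum_le_tsum_enorm
      _ = ∑' k, ∫⁻ a, ‖F k a‖ₑ ∂μ :=
          lintegral_tsum fun k => (hF k).aestronglyMeasurable.enorm
      _ = ∑' k, ENNReal.ofReal (∫ a, ‖F k a‖ ∂μ) := by
          simp_rw [ofReal_integral_norm_eq_lintegral_enorm (hF _)]
      _ = _ := (ENNReal.ofReal_tsum_of_nonneg
          (fun k => integral_nonneg fun a => norm_nonneg _) hsum).symm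
  have hi : Integrable (fun a => ∑' k, F k a) μ := ⟨hm, hle.trans_lt ENNReal.ofReal_lt_top⟩
  refine ⟨hi, ?_⟩
  rw [← ofReal_integral_norm_eq_lintegral_enorm hi] at hle
  exact (ENNReal.ofReal_le_ofReal_iff
    (tsum_nonneg fun k => integral_nonneg fun a => norm_nonneg _)).1 hle

/-- The coefficient of `(z / 2) ^ (2 * k)` in the power series of `(z / 2) ^ (-ν) * J_ν(z)`. -/
noncomputable def besselCoeff (ν : ℂ) (k : ℕ) : ℂ :=
  (-1 : ℂ) ^ k / ((k.factorial : ℂ) * Complex.Gamma (ν + k + 1))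

/-- The even entire function `(z / 2) ^ (-ν) * J_ν(z)`, that is `J_ν` without its branched factor. -/
noncomputable def besselSeries (ν z : ℂ) : ℂ :=
  ∑' k : ℕ, besselCoeff ν k * (z / 2) ^ (2 * k)

theorem besselJ_eq_cpow_mul_besselSeries (ν z : ℂ) :
    besselJ ν z = (z / 2) ^ ν * besselSeries ν z := rfl

theorem Gamma_add_natCast_add_one_ne_zero {ν : ℂ} (hν : -1 < ν.re) (k : ℕ) :
    Complex.Gamma (ν + k + 1) ≠ 0 := by
  refine Complex.Gamma_ne_zero_of_re_pos ?_
  simp only [Complex.add_re, Complex.natCast_re, Complex.one_re]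
  have : (0 : ℝ) ≤ k := k.cast_nonneg
  linarith

theorem Gamma_add_natCast_succ_add_one {ν : ℂ} (hν : -1 < ν.re) (k : ℕ) :
    Complex.Gamma (ν + (k + 1 : ℕ) + 1) = (ν + k + 1) * Complex.Gamma (ν + k + 1) := by
  rw [← Complex.Gamma_add_one]
  · push_cast; ring_nf
  · intro h
    have := congrArg Complex.re h
    simp only [Complex.add_re, Complex.natCast_re, Complex.one_re, Complex.zero_re] at this
    have : (0 : ℝ) ≤ k := k.cast_nonneg
    linarith

theorem re_add_natCast_add_one_le_norm (ν : ℂ) (k : ℕ) : ν.re + k + 1 ≤ ‖ν + k + 1‖ := by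
  simpa using Complex.re_le_norm (ν + k + 1)

/-- For complex order the absolute moments produce `Γ(Re ν + k + 1)` and the coefficients
`1 / |Γ(ν + k + 1)|`. Their quotient is bounded in `k`, since `Re ν + j ≤ |ν + j|` for all `j ≥ 1`. -/
theorem Gamma_re_le_mul_norm_Gamma {ν : ℂ} (hν : -1 < ν.re) (k : ℕ) :
    Real.Gamma (ν.re + k + 1) ≤
      Real.Gamma (ν.re + 1) / ‖Complex.Gamma (ν + 1)‖ * ‖Complex.Gamma (ν + k + 1)‖ := by
  have h0 : ‖Complex.Gamma (ν + 1)‖ ≠ 0 := by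
    simpa using Gamma_add_natCast_add_one_ne_zero hν 0
  have hC : 0 ≤ Real.Gamma (ν.re + 1) / ‖Complex.Gamma (ν + 1)‖ :=
    div_nonneg (Real.Gamma_pos_of_pos (by linarith)).le (norm_nonneg _)
  induction k with
  | zero => simp [h0]
  | succ k ih =>
    have hk : 0 < ν.re + k + 1 := by
      have : (0 : ℝ) ≤ k := k.cast_nonneg
      linarith
    rw [Gamma_add_natCast_succ_add_one hν, norm_mul,
      show ν.re + (k + 1 : ℕ) + 1 = (ν.re + k + 1) + 1 by push_cast; ring,
      Real.Gamma_add_one hk.ne']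
    calc (ν.re + k + 1) * Real.Gamma (ν.re + k + 1)
        ≤ ‖ν + k + 1‖ * (Real.Gamma (ν.re + 1) / ‖Complex.Gamma (ν + 1)‖ *
            ‖Complex.Gamma (ν + k + 1)‖) := by
          gcongr
          exact re_add_natCast_add_one_le_norm ν k
      _ = _ := by ring

theorem norm_besselCoeff (ν : ℂ) (k : ℕ) :
    ‖besselCoeff ν k‖ = 1 / (k.factorial * ‖Complex.Gamma (ν + k + 1)‖) := by
  simp [besselCoeff]

theorem pow_mul_norm_Gamma_le {ν : ℂ} (hν : -1 < ν.re) (k : ℕ) :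
    (ν.re + 1) ^ k * ‖Complex.Gamma (ν + 1)‖ ≤ ‖Complex.Gamma (ν + k + 1)‖ := by
  induction k with
  | zero => simp
  | succ k ih =>
    have : (0 : ℝ) ≤ k := k.cast_nonneg
    have h1 : ν.re + 1 ≤ ‖ν + k + 1‖ := by
      linarith [re_add_natCast_add_one_le_norm ν k]
    have h2 : 0 ≤ ν.re + 1 := by linarith
    rw [Gamma_add_natCast_succ_add_one hν, norm_mul, pow_succ', mul_assoc]
    gcongr

theorem summable_besselCoeff_mul_pow {ν : ℂ} (hν : -1 < ν.re) (w : ℂ) :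
    Summable fun k => besselCoeff ν k * w ^ k := by
  have hδ : 0 < ν.re + 1 := by linarith
  have h0 : 0 < ‖Complex.Gamma (ν + 1)‖ := by
    simpa using Gamma_add_natCast_add_one_ne_zero hν 0
  refine Summable.of_norm_bounded
    ((Real.summable_pow_div_factorial (‖w‖ / (ν.re + 1))).mul_left ‖Complex.Gamma (ν + 1)‖⁻¹)
    fun k => ?_
  rw [norm_mul, norm_pow, norm_besselCoeff]
  have := pow_mul_norm_Gamma_le hν k
  calc 1 / (k.factorial * ‖Complex.Gamma (ν + k + 1)‖) * ‖w‖ ^ k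
      ≤ 1 / (k.factorial * ((ν.re + 1) ^ k * ‖Complex.Gamma (ν + 1)‖)) * ‖w‖ ^ k := by
        gcongr
    _ = _ := by rw [div_pow]; field_simp

/-- Weber's integral for `besselSeries`: integrability, the value, and a bound on the `L¹` norm whose
constant does not depend on `ρ`. All three come from integrating the power series termwise. -/
theorem weber_integral_besselSeries {ν : ℂ} (hν : -1 < ν.re) (x : ℝ) {ρ : ℝ} (hρ : 0 < ρ) :
    IntegrableOn (fun y : ℝ => (y : ℂ) ^ (2 * ν + 1) * besselSeries ν (x * y) *
        Complex.exp (-(ρ * y ^ 2))) (Ioi 0) ∧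
    (∫ y in Ioi (0 : ℝ), (y : ℂ) ^ (2 * ν + 1) * besselSeries ν (x * y) *
        Complex.exp (-(ρ * y ^ 2))) =
      1 / 2 * (ρ : ℂ) ^ (-ν - 1) * Complex.exp (-((x ^ 2 / 4 : ℝ) / ρ)) ∧
    ∫ y in Ioi (0 : ℝ), ‖(y : ℂ) ^ (2 * ν + 1) * besselSeries ν (x * y) *
        Complex.exp (-(ρ * y ^ 2))‖ ≤
      1 / 2 * (Real.Gamma (ν.re + 1) / ‖Complex.Gamma (ν + 1)‖) * ρ ^ (-ν.re - 1) *
        Real.exp (x ^ 2 / 4 / ρ) := by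
  set C := Real.Gamma (ν.re + 1) / ‖Complex.Gamma (ν + 1)‖ with hC
  have hC0 : 0 ≤ C := div_nonneg (Real.Gamma_pos_of_pos (by linarith)).le (norm_nonneg _)
  -- The `k`-th term involves the power `y ^ (2 * ν + 1 + 2 * k) = y ^ (2 * s k - 1)`.
  let s : ℕ → ℂ := fun k => ν + k + 1
  have hsre (k : ℕ) : (s k).re = ν.re + k + 1 := by simp [s]
  have hs (k : ℕ) : 0 < (s k).re := by
    have : (0 : ℝ) ≤ k := k.cast_nonneg
    rw [hsre]; linarith
  let F : ℕ → ℝ → ℂ := fun k y => besselCoeff ν k * (x / 2 : ℂ) ^ (2 * k) *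
    ((y : ℂ) ^ (2 * s k - 1) * Complex.exp (-(ρ * y ^ 2)))
  have hFi (k : ℕ) : IntegrableOn (F k) (Ioi 0) :=
    (integrableOn_cpow_mul_exp_neg_mul_sq (hs k) hρ).const_mul _
  have hFeq (k : ℕ) {y : ℝ} (hy : 0 < y) : F k y = (y : ℂ) ^ (2 * ν + 1) *
      (besselCoeff ν k * (x * y / 2 : ℂ) ^ (2 * k)) * Complex.exp (-(ρ * y ^ 2)) := by
    have : (y : ℂ) ^ (2 * s k - 1) = (y : ℂ) ^ (2 * ν + 1) * (y : ℂ) ^ (2 * k) := by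
      rw [← Complex.cpow_natCast, ← Complex.cpow_add _ _ (by exact_mod_cast hy.ne')]
      congr 1
      simp only [s]; push_cast; ring
    simp only [F, this]
    ring
  have hFs {y : ℝ} : Summable fun k => besselCoeff ν k * (x * y / 2 : ℂ) ^ (2 * k) := by
    simpa [pow_mul] using summable_besselCoeff_mul_pow hν ((x * y / 2 : ℂ) ^ 2)
  have hFt {y : ℝ} (hy : 0 < y) : ∑' k, F k y = (y : ℂ) ^ (2 * ν + 1) * besselSeries ν (x * y) *
      Complex.exp (-(ρ * y ^ 2)) := by
    simp only [hFeq _ hy]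
    rw [tsum_mul_right, tsum_mul_left, besselSeries]
  have hpow (k : ℕ) (r : ℝ) : (x ^ 2 / 4 * r) ^ k = (x / 2) ^ (2 * k) * r ^ k := by
    rw [pow_mul, ← mul_pow]; ring_nf
  have hnorm (k : ℕ) : ∫ y in Ioi (0 : ℝ), ‖F k y‖ ≤
      1 / 2 * C * ρ ^ (-ν.re - 1) * ((x ^ 2 / 4 / ρ) ^ k / k.factorial) := by
    simp only [F]
    simp_rw [norm_mul (besselCoeff ν k * _)]
    rw [integral_const_mul, integral_norm_cpow_mul_exp_neg_mul_sq (hs k) hρ, norm_mul,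
      norm_besselCoeff, hsre]
    have hG : 0 < ‖Complex.Gamma (ν + k + 1)‖ := by
      simpa using Gamma_add_natCast_add_one_ne_zero hν k
    have e1 : ‖(x / 2 : ℂ) ^ (2 * k)‖ = (x / 2) ^ (2 * k) := by
      rw [norm_pow, pow_mul, pow_mul]; simp [div_pow]
    have e2 : ρ ^ (-(ν.re + k + 1)) = ρ ^ (-ν.re - 1) * (ρ⁻¹) ^ k := by
      rw [← Real.rpow_natCast, ← Real.rpow_neg_one, ← Real.rpow_mul hρ.le, ← Real.rpow_add hρ]
      ring_nf
    rw [e1, e2, div_eq_mul_inv (x ^ 2 / 4) ρ, hpow]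
    have hx0 : 0 ≤ (x / 2) ^ (2 * k) := by rw [pow_mul]; positivity
    calc _ ≤ 1 / (k.factorial * ‖Complex.Gamma (ν + k + 1)‖) * (x / 2) ^ (2 * k) *
          (1 / 2 * (ρ ^ (-ν.re - 1) * (ρ⁻¹) ^ k) * (C * ‖Complex.Gamma (ν + k + 1)‖)) := by
            gcongr
            exact Gamma_re_le_mul_norm_Gamma hν k
      _ = _ := by field_simp
  have hbs : HasSum (fun k : ℕ => 1 / 2 * C * ρ ^ (-ν.re - 1) *
      ((x ^ 2 / 4 / ρ) ^ k / k.factorial))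
      (1 / 2 * C * ρ ^ (-ν.re - 1) * Real.exp (x ^ 2 / 4 / ρ)) := by
    have h := NormedSpace.expSeries_div_hasSum_exp (x ^ 2 / 4 / ρ)
    rw [← Real.exp_eq_exp_ℝ] at h
    exact h.mul_left _
  have hFn : Summable fun k => ∫ y in Ioi (0 : ℝ), ‖F k y‖ :=
    Summable.of_nonneg_of_le (fun k => integral_nonneg fun _ => norm_nonneg _) hnorm hbs.summable
  have hae : ∀ᵐ y ∂volume.restrict (Ioi (0 : ℝ)), Summable fun k => F k y := by
    refine (ae_restrict_iff' measurableSet_Ioi).2 (.of_forall fun y hy => ?_)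
    simp only [hFeq _ hy]
    exact (hFs.mul_left _).mul_right _
  obtain ⟨h1, h2⟩ := integrable_tsum_and_integral_norm_tsum_le hFi hFn hae
  have h3 := hasSum_integral_of_summable_integral_norm hFi hFn
  have hFk (k : ℕ) : ∫ y in Ioi (0 : ℝ), F k y = 1 / 2 * (ρ : ℂ) ^ (-ν - 1) *
      ((-((x ^ 2 / 4 : ℝ) / ρ)) ^ k / k.factorial) := by
    simp only [F]
    rw [integral_const_mul, integral_cpow_mul_exp_neg_mul_sq (hs k) hρ, besselCoeff]
    have hG := Gamma_add_natCast_add_one_ne_zero hν k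
    have hρ' : (ρ : ℂ) ≠ 0 := by exact_mod_cast hρ.ne'
    have e2 : (ρ : ℂ) ^ (-(ν + k + 1)) = (ρ : ℂ) ^ (-ν - 1) * ((ρ : ℂ)⁻¹) ^ k := by
      rw [inv_pow, ← Complex.cpow_natCast, ← Complex.cpow_neg, ← Complex.cpow_add _ _ hρ']
      ring_nf
    have e3 : (-(((x ^ 2 / 4 : ℝ) : ℂ) / ρ)) ^ k =
        (-1) ^ k * (x / 2 : ℂ) ^ (2 * k) * ((ρ : ℂ)⁻¹) ^ k := by
      rw [pow_mul, ← mul_pow, ← mul_pow]; push_cast; ring_nf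
    rw [e3, show -s k = -(ν + k + 1) from rfl, e2, show s k = ν + k + 1 from rfl]
    field_simp
  refine ⟨?_, ?_, ?_⟩
  · exact IntegrableOn.congr_fun h1 (fun y hy => hFt hy) measurableSet_Ioi
  · rw [← setIntegral_congr_fun measurableSet_Ioi (fun y hy => hFt hy)]
    refine h3.unique ?_
    simp only [hFk]
    have h := NormedSpace.expSeries_div_hasSum_exp (-(((x ^ 2 / 4 : ℝ) : ℂ) / ρ))
    rw [← Complex.exp_eq_exp_ℂ] at h
    exact h.mul_left _
  · rw [← hbs.tsum_eq, ← setIntegral_congr_fun measurableSet_Ioi (fun y hy => congrArg norm (hFt hy))]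
    exact h2.trans (hFn.tsum_le_tsum hnorm hbs.summable)

/-! ### The kernel integral -/

theorem continuousOn_cpow_mul_exp_neg_div (s : ℂ) (b : ℝ) :
    ContinuousOn (fun τ : ℝ => (τ : ℂ) ^ s * Complex.exp (-(b / τ))) (Ioi 0) := by
  intro τ hτ
  have hτ' : (τ : ℂ) ≠ 0 := by exact_mod_cast (ne_of_gt hτ)
  refine ContinuousAt.continuousWithinAt (ContinuousAt.mul ?_ (by fun_prop (disch := assumption)))
  exact Complex.continuousAt_ofReal_cpow_const _ _ (Or.inr (ne_of_gt hτ))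

theorem norm_cpow_mul_exp_neg_div (s : ℂ) (b : ℝ) {τ : ℝ} (hτ : 0 < τ) :
    ‖(τ : ℂ) ^ s * Complex.exp (-(b / τ))‖ = τ ^ s.re * Real.exp (-(b / τ)) := by
  rw [norm_mul, Complex.norm_cpow_eq_rpow_re_of_pos hτ, Complex.norm_exp]
  norm_cast

theorem integrableOn_rpow_neg_two_mul_exp_neg_div {c : ℝ} (hc : 0 < c) :
    IntegrableOn (fun t : ℝ => t ^ (-2 : ℝ) * Real.exp (-(c / t))) (Ioi 0) := by
  refine (integrableOn_cpow_neg_two_mul_exp_neg_div hc).norm.congr ?_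
  refine (ae_restrict_iff' measurableSet_Ioi).2 (.of_forall fun t ht => ?_)
  simp only [norm_cpow_mul_exp_neg_div _ _ ht]
  simp

/-- The bound by `τ ^ (-2)`, which is integrable against `exp (-(b / τ))` and dominates the `τ`-integrand
of the regularized integral for all `ε`. -/
theorem rpow_sub_one_mul_rpow_neg_le {σ : ℝ} (hσ : -1 < σ) {τ ε : ℝ} (hτ : 0 < τ) (hε : 0 ≤ ε) :
    τ ^ (σ - 1) * (ε + τ) ^ (-σ - 1) ≤ τ ^ (-2 : ℝ) := by
  calc τ ^ (σ - 1) * (ε + τ) ^ (-σ - 1) ≤ τ ^ (σ - 1) * τ ^ (-σ - 1) := by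
        refine mul_le_mul_of_nonneg_left ?_ (by positivity)
        exact Real.rpow_le_rpow_of_nonpos hτ (by linarith) (by linarith)
    _ = τ ^ (-2 : ℝ) := by rw [← Real.rpow_add hτ]; ring_nf

/-- Absolute convergence of the regularized double integral in `(y, τ)`. The regularization keeps the
Gaussian exponent `ε + τ` away from `0`, so that the factor `exp (x ^ 2 / (4 * (ε + τ)))` of the
`L¹` bound in Weber's integral stays bounded. -/
theorem integrable_gaussian_kernel {ν : ℂ} (hν : -1 < ν.re) (x : ℝ) {u ε : ℝ} (hu : 0 < u)
    (hε : 0 < ε) :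
    Integrable (fun p : ℝ × ℝ => ((p.2 : ℂ) ^ (ν - 1) * Complex.exp (-((u ^ 2 / 4 : ℝ) / p.2))) *
        ((p.1 : ℂ) ^ (2 * ν + 1) * besselSeries ν (x * p.1) *
          Complex.exp (-((ε + p.2 : ℝ) * p.1 ^ 2))))
      ((volume.restrict (Ioi 0)).prod (volume.restrict (Ioi 0))) := by
  set C := Real.Gamma (ν.re + 1) / ‖Complex.Gamma (ν + 1)‖
  have hC0 : 0 ≤ C := div_nonneg (Real.Gamma_pos_of_pos (by linarith)).le (norm_nonneg _)
  have hm : AEStronglyMeasurable (fun p : ℝ × ℝ =>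
      ((p.2 : ℂ) ^ (ν - 1) * Complex.exp (-((u ^ 2 / 4 : ℝ) / p.2))) *
        ((p.1 : ℂ) ^ (2 * ν + 1) * besselSeries ν (x * p.1) *
          Complex.exp (-((ε + p.2 : ℝ) * p.1 ^ 2))))
      ((volume.restrict (Ioi 0)).prod (volume.restrict (Ioi 0))) := by
    have h1 := (weber_integral_besselSeries hν x hε).1.aestronglyMeasurable
    have h2 := (continuousOn_cpow_mul_exp_neg_div (ν - 1) (u ^ 2 / 4)).aestronglyMeasurable
      measurableSet_Ioi (μ := volume)
    have h3 : Continuous fun p : ℝ × ℝ => Complex.exp (-(p.2 * p.1 ^ 2)) := by fun_prop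
    refine ((h2.comp_snd (μ := volume.restrict (Ioi 0))).mul
      ((h1.comp_fst (ν := volume.restrict (Ioi 0))).mul h3.aestronglyMeasurable)).congr
      (.of_forall fun p => ?_)
    simp only [Pi.mul_apply]
    rw [mul_assoc _ (Complex.exp _) (Complex.exp _), ← Complex.exp_add]
    push_cast
    ring_nf
  refine (integrable_prod_iff' hm).2 ⟨?_, ?_⟩
  · refine (ae_restrict_iff' measurableSet_Ioi).2 (.of_forall fun τ hτ => ?_)
    dsimp only
    exact Integrable.const_mul (weber_integral_besselSeries hν x (add_pos hε hτ)).1 _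
  · refine ((integrableOn_rpow_neg_two_mul_exp_neg_div (c := u ^ 2 / 4) (by positivity)).const_mul
      (1 / 2 * C * Real.exp (x ^ 2 / 4 / ε))).mono' hm.norm.prod_swap.integral_prod_right' ?_
    refine (ae_restrict_iff' measurableSet_Ioi).2 (.of_forall fun τ hτ => ?_)
    have hτ : 0 < τ := hτ
    rw [Real.norm_of_nonneg (integral_nonneg fun _ => norm_nonneg _)]
    simp_rw [norm_mul ((τ : ℂ) ^ (ν - 1) * _)]
    rw [integral_const_mul, norm_cpow_mul_exp_neg_div _ _ hτ]
    calc _ ≤ τ ^ (ν - 1).re * Real.exp (-(u ^ 2 / 4 / τ)) *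
          (1 / 2 * C * (ε + τ) ^ (-ν.re - 1) * Real.exp (x ^ 2 / 4 / (ε + τ))) := by
          gcongr
          exact (weber_integral_besselSeries hν x (add_pos hε hτ)).2.2
      _ = 1 / 2 * C * Real.exp (x ^ 2 / 4 / (ε + τ)) *
          ((τ ^ (ν.re - 1) * (ε + τ) ^ (-ν.re - 1)) * Real.exp (-(u ^ 2 / 4 / τ))) := by
          rw [Complex.sub_re, Complex.one_re]; ring
      _ ≤ 1 / 2 * C * Real.exp (x ^ 2 / 4 / ε) *
          (τ ^ (-2 : ℝ) * Real.exp (-(u ^ 2 / 4 / τ))) := by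
          have := rpow_sub_one_mul_rpow_neg_le hν hτ hε.le
          gcongr
          linarith

theorem cpow_add_one_eq {z : ℂ} (hz : z ≠ 0) (s : ℂ) : z ^ (s + 1) = z ^ s * z := by
  rw [Complex.cpow_add _ _ hz, Complex.cpow_one]

theorem cpow_mul_cpow_eq {ν : ℂ} {x u y : ℝ} (hx : 0 < x) (hu : 0 < u) (hy : 0 < y) :
    (y : ℂ) ^ (2 * ν + 1) * ((u / (2 * y) : ℝ) : ℂ) ^ ν =
      (u : ℂ) ^ ν / (x : ℂ) ^ ν * (y * (((x * y : ℝ) : ℂ) / 2) ^ ν) := by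
  have hy0 : (y : ℂ) ≠ 0 := by exact_mod_cast hy.ne'
  have h0 {a : ℝ} (ha : 0 < a) : (a : ℂ) ^ ν ≠ 0 := by
    rw [Complex.cpow_ne_zero_iff]
    exact Or.inl (by exact_mod_cast ha.ne')
  have e1 : (u : ℂ) ^ ν = ((u / (2 * y) : ℝ) : ℂ) ^ ν * ((2 : ℝ) : ℂ) ^ ν * (y : ℂ) ^ ν := by
    rw [mul_assoc, ← Complex.mul_cpow_ofReal_nonneg two_pos.le hy.le, ← Complex.ofReal_mul,
      ← Complex.mul_cpow_ofReal_nonneg (by positivity) (by positivity), ← Complex.ofReal_mul]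
    congr 2
    field_simp
  have e2 : (x : ℂ) ^ ν * (y : ℂ) ^ ν = (((x * y : ℝ) : ℂ) / 2) ^ ν * ((2 : ℝ) : ℂ) ^ ν := by
    rw [← Complex.mul_cpow_ofReal_nonneg hx.le hy.le,
      show ((x * y : ℝ) : ℂ) / 2 = ((x * y / 2 : ℝ) : ℂ) by push_cast; ring,
      ← Complex.mul_cpow_ofReal_nonneg (by positivity) two_pos.le]
    push_cast
    congr 1
    ring
  have e3 : (y : ℂ) ^ (2 * ν + 1) = (y : ℂ) ^ ν * (y : ℂ) ^ ν * y := by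
    rw [← Complex.cpow_add _ _ hy0, ← cpow_add_one_eq hy0]
    ring_nf
  rw [e3, div_mul_eq_mul_div, eq_div_iff (h0 hx), e1]
  linear_combination (y : ℂ) * (y : ℂ) ^ ν * ((u / (2 * y) : ℝ) : ℂ) ^ ν * e2

/-- The regularized kernel integral, by exchanging the integrals over `y` and `τ`. -/
theorem integral_besselJ_mul_besselK_mul_exp {ν : ℂ} (hν : -1 < ν.re) {x u ε : ℝ} (hx : 0 < x)
    (hu : 0 < u) (hε : 0 < ε) :
    2 * ((u : ℂ) ^ ν / (x : ℂ) ^ ν) *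
      ∫ y in Ioi (0 : ℝ), (y * besselJ ν ((x * y : ℝ) : ℂ) * besselK ν ((u * y : ℝ) : ℂ)) *
        Complex.exp (-(ε * y ^ 2)) =
    ∫ τ in Ioi (0 : ℝ), ((τ : ℂ) ^ (ν - 1) * Complex.exp (-((u ^ 2 / 4 : ℝ) / τ))) *
      (1 / 2 * ((ε + τ : ℝ) : ℂ) ^ (-ν - 1) *
        Complex.exp (-((x ^ 2 / 4 : ℝ) / (ε + τ : ℝ)))) := by
  have h := integral_integral_swap (f := fun y τ : ℝ => ((τ : ℂ) ^ (ν - 1) *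
    Complex.exp (-((u ^ 2 / 4 : ℝ) / τ))) * ((y : ℂ) ^ (2 * ν + 1) * besselSeries ν (x * y) *
          Complex.exp (-((ε + τ : ℝ) * y ^ 2)))) (integrable_gaussian_kernel hν x hu hε)
  rw [← integral_const_mul]
  refine Eq.trans (setIntegral_congr_fun measurableSet_Ioi fun y hy => ?_)
    (h.trans (setIntegral_congr_fun measurableSet_Ioi fun τ hτ => ?_))
  · have hy : 0 < y := hy
    have hK := integral_cpow_mul_exp_eq_besselK hν hu hy
    have e (τ : ℝ) : ((τ : ℂ) ^ (ν - 1) *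
        Complex.exp (-((u ^ 2 / 4 : ℝ) / τ))) * ((y : ℂ) ^ (2 * ν + 1) * besselSeries ν (x * y) *
          Complex.exp (-((ε + τ : ℝ) * y ^ 2))) =
        ((y : ℂ) ^ (2 * ν + 1) * besselSeries ν (x * y) * Complex.exp (-(ε * y ^ 2))) *
        ((τ : ℂ) ^ (ν - 1) * Complex.exp (-((y ^ 2 : ℝ) * τ) - (u ^ 2 / 4 : ℝ) / τ)) := by
      have : Complex.exp (-((u ^ 2 / 4 : ℝ) / τ)) * Complex.exp (-((ε + τ : ℝ) * y ^ 2)) =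
          Complex.exp (-(ε * y ^ 2)) *
            Complex.exp (-((y ^ 2 : ℝ) * τ) - (u ^ 2 / 4 : ℝ) / τ) := by
        rw [← Complex.exp_add, ← Complex.exp_add]
        push_cast
        ring_nf
      linear_combination (τ : ℂ) ^ (ν - 1) * ((y : ℂ) ^ (2 * ν + 1) * besselSeries ν (x * y)) * this
    simp only [e]
    rw [integral_const_mul, hK, besselJ_eq_cpow_mul_besselSeries]
    have hp := cpow_mul_cpow_eq (ν := ν) hx hu hy
    rw [← Complex.ofReal_mul x y]
    linear_combination (-2) * besselSeries ν ((x * y : ℝ) : ℂ) * Complex.exp (-(ε * y ^ 2)) *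
      besselK ν ((u * y : ℝ) : ℂ) * hp
  · rw [integral_const_mul, (weber_integral_besselSeries hν x (add_pos hε hτ)).2.1]

open Filter Topology in
/-- As `ε → 0` the powers `τ ^ (ν - 1)` and `(ε + τ) ^ (-ν - 1)` combine to `τ ^ (-2)`. -/
theorem tendsto_integral_shifted_kernel {ν : ℂ} (hν : -1 < ν.re) (x : ℝ) {u : ℝ} (hu : 0 < u) :
    Tendsto (fun ε : ℝ => ∫ τ in Ioi (0 : ℝ),
      ((τ : ℂ) ^ (ν - 1) * Complex.exp (-((u ^ 2 / 4 : ℝ) / τ))) *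
      (1 / 2 * ((ε + τ : ℝ) : ℂ) ^ (-ν - 1) *
        Complex.exp (-((x ^ 2 / 4 : ℝ) / (ε + τ : ℝ))))) (𝓝[>] 0)
      (𝓝 (∫ τ in Ioi (0 : ℝ), 1 / 2 * ((τ : ℂ) ^ (-2 : ℂ) *
        Complex.exp (-(((x ^ 2 + u ^ 2) / 4 : ℝ) / τ))))) := by
  refine tendsto_integral_filter_of_dominated_convergence
    (fun τ => 1 / 2 * (τ ^ (-2 : ℝ) * Real.exp (-(u ^ 2 / 4 / τ)))) ?_ ?_
    ((integrableOn_rpow_neg_two_mul_exp_neg_div (c := u ^ 2 / 4) (by positivity)).const_mul _) ?_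
  · filter_upwards [self_mem_nhdsWithin] with ε hε
    have hε : 0 < ε := hε
    refine ContinuousOn.aestronglyMeasurable ?_ measurableSet_Ioi
    refine (continuousOn_cpow_mul_exp_neg_div (ν - 1) (u ^ 2 / 4)).mul ?_
    have := (continuousOn_const (c := (1 / 2 : ℂ))).mul
      ((continuousOn_cpow_mul_exp_neg_div (-ν - 1) (x ^ 2 / 4)).comp
      (f := fun τ => ε + τ) (s := Ioi 0) (by fun_prop) (fun τ hτ => add_pos hε hτ))
    exact this.congr fun τ _ => mul_assoc _ _ _
  · filter_upwards [self_mem_nhdsWithin] with ε hε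
    have hε : 0 < ε := hε
    refine (ae_restrict_iff' measurableSet_Ioi).2 (.of_forall fun τ hτ => ?_)
    have hτ : 0 < τ := hτ
    rw [norm_mul, norm_cpow_mul_exp_neg_div _ _ hτ, mul_assoc (1 / 2 : ℂ), norm_mul,
      norm_cpow_mul_exp_neg_div _ _ (add_pos hε hτ)]
    have h1 := rpow_sub_one_mul_rpow_neg_le hν hτ hε.le
    have h2 : Real.exp (-(x ^ 2 / 4 / (ε + τ))) ≤ 1 := by
      rw [Real.exp_le_one_iff, neg_nonpos]; positivity
    calc _ = 1 / 2 * ((τ ^ (ν.re - 1) * (ε + τ) ^ (-ν.re - 1)) *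
          Real.exp (-(u ^ 2 / 4 / τ)) * Real.exp (-(x ^ 2 / 4 / (ε + τ)))) := by
          simp; ring
      _ ≤ 1 / 2 * (τ ^ (-2 : ℝ) * Real.exp (-(u ^ 2 / 4 / τ)) * 1) := by gcongr
      _ = _ := by rw [mul_one]
  · refine (ae_restrict_iff' measurableSet_Ioi).2 (.of_forall fun τ hτ => ?_)
    have hτ : 0 < τ := hτ
    have hτ0 : (τ : ℂ) ≠ 0 := by exact_mod_cast hτ.ne'
    have hshift : Tendsto (fun ε : ℝ => ε + τ) (𝓝[>] 0) (𝓝 τ) := by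
      have : Continuous fun ε : ℝ => ε + τ := by fun_prop
      simpa using (this.tendsto 0).mono_left nhdsWithin_le_nhds
    have hc := ((continuousOn_cpow_mul_exp_neg_div (-ν - 1) (x ^ 2 / 4)).continuousAt
      (Ioi_mem_nhds hτ)).tendsto.comp hshift
    have e : 1 / 2 * ((τ : ℂ) ^ (-2 : ℂ) * Complex.exp (-(((x ^ 2 + u ^ 2) / 4 : ℝ) / τ))) =
        ((τ : ℂ) ^ (ν - 1) * Complex.exp (-((u ^ 2 / 4 : ℝ) / τ))) *
        (1 / 2 * ((τ : ℂ) ^ (-ν - 1) * Complex.exp (-((x ^ 2 / 4 : ℝ) / τ)))) := by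
      have e1 : (τ : ℂ) ^ (-2 : ℂ) = (τ : ℂ) ^ (ν - 1) * (τ : ℂ) ^ (-ν - 1) := by
        rw [← Complex.cpow_add _ _ hτ0]; ring_nf
      have e2 : Complex.exp (-(((x ^ 2 + u ^ 2) / 4 : ℝ) / τ)) =
          Complex.exp (-((u ^ 2 / 4 : ℝ) / τ)) * Complex.exp (-((x ^ 2 / 4 : ℝ) / τ)) := by
        rw [← Complex.exp_add]; push_cast; ring_nf
      rw [e1, e2]; ring
    rw [e]
    refine ((hc.const_mul (1 / 2)).const_mul
      ((τ : ℂ) ^ (ν - 1) * Complex.exp (-((u ^ 2 / 4 : ℝ) / τ)))).congr fun ε => ?_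
    simp only [Function.comp_apply, mul_assoc]

open Filter Topology in
/-- The kernel integral `∫₀^∞ y J_ν(xy) K_ν(uy) dy = (x/u)^ν / (x² + u²)`. Its absolute convergence is
taken as a hypothesis, because it is the dominating function in the limit `ε → 0`. -/
theorem integral_besselJ_mul_besselK {ν : ℂ} (hν : -1 < ν.re) {x u : ℝ} (hx : 0 < x)
    (hu : 0 < u)
    (hint : IntegrableOn (fun y : ℝ =>
      y * besselJ ν ((x * y : ℝ) : ℂ) * besselK ν ((u * y : ℝ) : ℂ)) (Ioi 0)) :
    ∫ y in Ioi (0 : ℝ), y * besselJ ν ((x * y : ℝ) : ℂ) * besselK ν ((u * y : ℝ) : ℂ) =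
      (x : ℂ) ^ ν / (u : ℂ) ^ ν / ((x : ℂ) ^ 2 + (u : ℂ) ^ 2) := by
  have h0 {a : ℝ} (ha : 0 < a) : (a : ℂ) ^ ν ≠ 0 := by
    rw [Complex.cpow_ne_zero_iff]
    exact Or.inl (by exact_mod_cast ha.ne')
  have hL : Tendsto (fun ε : ℝ => 2 * ((u : ℂ) ^ ν / (x : ℂ) ^ ν) *
      ∫ y in Ioi (0 : ℝ), (y * besselJ ν ((x * y : ℝ) : ℂ) * besselK ν ((u * y : ℝ) : ℂ)) *
        Complex.exp (-(ε * y ^ 2))) (𝓝[>] 0) (𝓝 (2 * ((u : ℂ) ^ ν / (x : ℂ) ^ ν) *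
      ∫ y in Ioi (0 : ℝ), y * besselJ ν ((x * y : ℝ) : ℂ) * besselK ν ((u * y : ℝ) : ℂ))) := by
    refine Tendsto.const_mul _ (tendsto_integral_filter_of_dominated_convergence _ ?_ ?_
      hint.norm ?_)
    · refine .of_forall fun ε => hint.aestronglyMeasurable.mul ?_
      exact (by fun_prop : Continuous fun y : ℝ => Complex.exp (-(ε * y ^ 2))).aestronglyMeasurable
    · filter_upwards [self_mem_nhdsWithin] with ε hε
      refine .of_forall fun y => ?_
      rw [norm_mul]
      refine mul_le_of_le_one_right (norm_nonneg _) ?_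
      rw [Complex.norm_exp]
      norm_cast
      rw [Real.exp_le_one_iff]
      have : 0 < ε := hε
      have := mul_nonneg this.le (sq_nonneg y)
      linarith
    · refine .of_forall fun y => ?_
      have : Continuous fun ε : ℝ => (y * besselJ ν ((x * y : ℝ) : ℂ) *
        besselK ν ((u * y : ℝ) : ℂ)) * Complex.exp (-(ε * y ^ 2)) := by fun_prop
      simpa using (this.tendsto 0).mono_left nhdsWithin_le_nhds
  have hR := tendsto_integral_shifted_kernel hν x hu
  have heq := tendsto_nhds_unique (hL.congr' (by
    filter_upwards [self_mem_nhdsWithin] with ε hε using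
      integral_besselJ_mul_besselK_mul_exp hν hx hu hε)) hR
  rw [integral_const_mul, integral_cpow_neg_two_mul_exp_neg_div (by positivity)] at heq
  have hxu : (x : ℂ) ^ 2 + (u : ℂ) ^ 2 ≠ 0 := by exact_mod_cast (by positivity)
  have hx' := h0 hx
  have hu' := h0 hu
  push_cast at heq ⊢
  generalize (∫ y in Ioi (0 : ℝ), _ : ℂ) = I at heq ⊢
  field_simp at heq ⊢
  linear_combination heq / 4

/-! ### Parseval–Goldstein identities -/

/-- Both iterated integrals have the integrand
`x^{ν+1/2} u^{-ν+1/2} f(x) g(u) / (x² + u²)`. -/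
theorem widderIntegrand_weight (ν : ℂ) (f g : ℝ → ℂ) {x u : ℝ} (hx : 0 < x) (hu : 0 < u) :
    (x : ℂ) ^ (ν + 1 / 2) * f x * widderIntegrand (fun u => (u : ℂ) ^ (-ν - 1 / 2) * g u) x u =
      (u : ℂ) ^ (-ν + 1 / 2) * g u *
        widderIntegrand (fun x => (x : ℂ) ^ (ν - 1 / 2) * f x) u x := by
  have hx0 : (x : ℂ) ≠ 0 := by exact_mod_cast hx.ne'
  have hu0 : (u : ℂ) ≠ 0 := by exact_mod_cast hu.ne'
  have e1 : (x : ℂ) ^ (ν + 1 / 2) = (x : ℂ) ^ (ν - 1 / 2) * x := by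
    rw [← cpow_add_one_eq hx0]; ring_nf
  have e2 : (u : ℂ) ^ (-ν + 1 / 2) = (u : ℂ) ^ (-ν - 1 / 2) * u := by
    rw [← cpow_add_one_eq hu0]; ring_nf
  simp only [widderIntegrand, e1, e2, add_comm ((u : ℂ) ^ 2)]
  ring

theorem integral_widder_symm (ν : ℂ) (f g : ℝ → ℂ)
    (h : IntegrableOn (fun p : ℝ × ℝ => (p.1 : ℂ) ^ (ν + 1 / 2) * f p.1 *
          widderIntegrand (fun u => (u : ℂ) ^ (-ν - 1 / 2) * g u) p.1 p.2)
        (Ioi (0 : ℝ) ×ˢ Ioi (0 : ℝ))) :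
    (∫ x in Ioi (0 : ℝ), (x : ℂ) ^ (ν + 1 / 2) * f x *
          widderTransform (fun u => (u : ℂ) ^ (-ν - 1 / 2) * g u) x) =
        ∫ u in Ioi (0 : ℝ), (u : ℂ) ^ (-ν + 1 / 2) * g u *
          widderTransform (fun x => (x : ℂ) ^ (ν - 1 / 2) * f x) u := by
  rw [IntegrableOn, Measure.volume_eq_prod, ← Measure.prod_restrict] at h
  have := integral_integral_swap (f := fun x u : ℝ => (x : ℂ) ^ (ν + 1 / 2) * f x *
          widderIntegrand (fun u => (u : ℂ) ^ (-ν - 1 / 2) * g u) x u) h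
  simp only [widderTransform, ← integral_const_mul]
  rw [this]
  refine setIntegral_congr_fun measurableSet_Ioi fun u hu => ?_
  exact setIntegral_congr_fun measurableSet_Ioi fun x hx => widderIntegrand_weight ν f g hx hu

theorem hankelIntegrand_mul_kIntegrand (ν : ℂ) (f g : ℝ → ℂ) {x u y : ℝ} (hx : 0 < x) (hu : 0 < u)
    (hy : 0 < y) :
    hankelIntegrand ν f y x * kIntegrand ν g y u =
      ((Real.sqrt x * Real.sqrt u : ℝ) * f x * g u) *
        (y * besselJ ν ((x * y : ℝ) : ℂ) * besselK ν ((u * y : ℝ) : ℂ)) := by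
  have hyy : ((Real.sqrt y : ℝ) : ℂ) * (Real.sqrt y : ℝ) = y := by
    exact_mod_cast Real.mul_self_sqrt hy.le
  rw [hankelIntegrand, kIntegrand, Real.sqrt_mul hx.le, Real.sqrt_mul hu.le]
  push_cast
  rw [← hyy]
  ring

theorem sqrt_mul_cpow_div (ν : ℂ) {x u : ℝ} (hx : 0 < x) (hu : 0 < u) :
    ((Real.sqrt x * Real.sqrt u : ℝ) : ℂ) * ((x : ℂ) ^ ν / (u : ℂ) ^ ν) =
      (x : ℂ) ^ (ν + 1 / 2) * (u * (u : ℂ) ^ (-ν - 1 / 2)) := by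
  have hx0 : (x : ℂ) ≠ 0 := by exact_mod_cast hx.ne'
  have hu0 : (u : ℂ) ≠ 0 := by exact_mod_cast hu.ne'
  have hs {a : ℝ} (ha : 0 < a) : ((Real.sqrt a : ℝ) : ℂ) = (a : ℂ) ^ (1 / 2 : ℂ) := by
    rw [Real.sqrt_eq_rpow, Complex.ofReal_cpow ha.le]
    push_cast
    rfl
  have e : (u : ℂ) * (u : ℂ) ^ (-ν - 1 / 2) = (u : ℂ) ^ (1 / 2 : ℂ) * ((u : ℂ) ^ ν)⁻¹ := by
    rw [← Complex.cpow_neg, ← Complex.cpow_add _ _ hu0, mul_comm, ← cpow_add_one_eq hu0]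
    ring_nf
  rw [Complex.ofReal_mul, hs hx, hs hu, e, Complex.cpow_add _ _ hx0]
  ring

/-- Inner integral of the triple integral. Where `f x * g u = 0` the hypothesis says nothing about the
Bessel functions, but both sides vanish. -/
theorem integral_hankelIntegrand_mul_kIntegrand {ν : ℂ} (hν : -1 < ν.re) (f g : ℝ → ℂ) {x u : ℝ}
    (hx : 0 < x) (hu : 0 < u)
    (h : IntegrableOn (fun y => hankelIntegrand ν f y x * kIntegrand ν g y u) (Ioi 0)) :
    ∫ y in Ioi (0 : ℝ), hankelIntegrand ν f y x * kIntegrand ν g y u =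
      (x : ℂ) ^ (ν + 1 / 2) * f x *
        widderIntegrand (fun u => (u : ℂ) ^ (-ν - 1 / 2) * g u) x u := by
  have he := fun y (hy : y ∈ Ioi (0 : ℝ)) => hankelIntegrand_mul_kIntegrand ν f g hx hu hy
  rw [setIntegral_congr_fun measurableSet_Ioi he, integral_const_mul]
  by_cases hc : f x * g u = 0
  · rcases mul_eq_zero.1 hc with hc | hc <;> simp [hc, widderIntegrand]
  have hc' : ((Real.sqrt x * Real.sqrt u : ℝ) * f x * g u : ℂ) ≠ 0 := by
    rw [mul_assoc]
    exact mul_ne_zero (by exact_mod_cast (by positivity)) hc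
  have hi : IntegrableOn (fun y : ℝ =>
      y * besselJ ν ((x * y : ℝ) : ℂ) * besselK ν ((u * y : ℝ) : ℂ)) (Ioi 0) := by
    have := (h.congr_fun he measurableSet_Ioi).const_mul
      ((Real.sqrt x * Real.sqrt u : ℝ) * f x * g u : ℂ)⁻¹
    simpa only [IntegrableOn, ← mul_assoc, inv_mul_cancel₀ hc', one_mul] using this
  rw [integral_besselJ_mul_besselK hν hx hu hi, widderIntegrand, add_comm ((u : ℂ) ^ 2)]
  linear_combination f x * g u / ((x : ℂ) ^ 2 + (u : ℂ) ^ 2) * sqrt_mul_cpow_div ν hx hu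

/-- Absolute convergence of the triple integral passes to the double integral over `(x, u)`, and the
first identity holds. -/
theorem integrableOn_widder_and_integral_hankel_mul_k {ν : ℂ} (hν : -1 < ν.re) (f g : ℝ → ℂ)
    (h : IntegrableOn
        (fun p : ℝ × ℝ × ℝ => hankelIntegrand ν f p.1 p.2.1 * kIntegrand ν g p.1 p.2.2)
        (Ioi (0 : ℝ) ×ˢ (Ioi (0 : ℝ) ×ˢ Ioi (0 : ℝ)))) :
    IntegrableOn (fun p : ℝ × ℝ => (p.1 : ℂ) ^ (ν + 1 / 2) * f p.1 *
          widderIntegrand (fun u => (u : ℂ) ^ (-ν - 1 / 2) * g u) p.1 p.2)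
        (Ioi (0 : ℝ) ×ˢ Ioi (0 : ℝ)) ∧
    (∫ y in Ioi (0 : ℝ), hankelTransform ν f y * kTransform ν g y) =
          ∫ x in Ioi (0 : ℝ), (x : ℂ) ^ (ν + 1 / 2) * f x *
            widderTransform (fun u => (u : ℂ) ^ (-ν - 1 / 2) * g u) x := by
  rw [IntegrableOn, Measure.volume_eq_prod, ← Measure.prod_restrict] at h
  have hae : (fun p : ℝ × ℝ => ∫ y in Ioi (0 : ℝ),
      hankelIntegrand ν f y p.1 * kIntegrand ν g y p.2)
      =ᵐ[volume.restrict (Ioi (0 : ℝ) ×ˢ Ioi (0 : ℝ))] fun p => (p.1 : ℂ) ^ (ν + 1 / 2) * f p.1 *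
          widderIntegrand (fun u => (u : ℂ) ^ (-ν - 1 / 2) * g u) p.1 p.2 := by
    filter_upwards [h.prod_left_ae, ae_restrict_mem (measurableSet_Ioi.prod measurableSet_Ioi)]
      with p hp hmem
    exact integral_hankelIntegrand_mul_kIntegrand hν f g hmem.1 hmem.2 hp
  have hW := h.integral_prod_right.congr hae
  refine ⟨hW, ?_⟩
  calc _ = ∫ y in Ioi (0 : ℝ), ∫ p in Ioi (0 : ℝ) ×ˢ Ioi (0 : ℝ),
        hankelIntegrand ν f y p.1 * kIntegrand ν g y p.2 := by
        refine integral_congr_ae (.of_forall fun y => ?_)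
        -- The product formula holds without integrability, so no exceptional `y` has to be removed.
        exact (setIntegral_prod_mul _ _ _ _).symm
    _ = ∫ p in Ioi (0 : ℝ) ×ˢ Ioi (0 : ℝ), ∫ y in Ioi (0 : ℝ),
        hankelIntegrand ν f y p.1 * kIntegrand ν g y p.2 := integral_integral_swap h
    _ = _ := integral_congr_ae hae
    _ = _ := by
        rw [Measure.volume_eq_prod, setIntegral_prod _ hW]
        simp only [widderTransform, integral_const_mul]

theorem theorem1 (ν : ℂ) (hν : -1 < ν.re) (f g : ℝ → ℂ)
    (hf : AEStronglyMeasurable f (volume.restrict (Ioi (0 : ℝ))))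
    (hg : AEStronglyMeasurable g (volume.restrict (Ioi (0 : ℝ)))) :
    -- the first two identities, when the integral of `H_ν{f; y} K_ν{g; y}` converges absolutely
    -- as an iterated integral over `(y, x, u)`
    (IntegrableOn
        (fun p : ℝ × ℝ × ℝ => hankelIntegrand ν f p.1 p.2.1 * kIntegrand ν g p.1 p.2.2)
        (Ioi (0 : ℝ) ×ˢ (Ioi (0 : ℝ) ×ˢ Ioi (0 : ℝ))) →
      (∫ y in Ioi (0 : ℝ), hankelTransform ν f y * kTransform ν g y) =
          ∫ x in Ioi (0 : ℝ), (x : ℂ) ^ (ν + 1 / 2) * f x *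
            widderTransform (fun u => (u : ℂ) ^ (-ν - 1 / 2) * g u) x ∧
      (∫ y in Ioi (0 : ℝ), hankelTransform ν f y * kTransform ν g y) =
          ∫ u in Ioi (0 : ℝ), (u : ℂ) ^ (-ν + 1 / 2) * g u *
            widderTransform (fun x => (x : ℂ) ^ (ν - 1 / 2) * f x) u) ∧
    -- the third identity, when the integral on its left converges absolutely as an iterated
    -- integral over `(x, u)`; the one on its right has the same integrand for `x, u > 0`
    (IntegrableOn
        (fun p : ℝ × ℝ => (p.1 : ℂ) ^ (ν + 1 / 2) * f p.1 *
          widderIntegrand (fun u => (u : ℂ) ^ (-ν - 1 / 2) * g u) p.1 p.2)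
        (Ioi (0 : ℝ) ×ˢ Ioi (0 : ℝ)) →
      (∫ x in Ioi (0 : ℝ), (x : ℂ) ^ (ν + 1 / 2) * f x *
          widderTransform (fun u => (u : ℂ) ^ (-ν - 1 / 2) * g u) x) =
        ∫ u in Ioi (0 : ℝ), (u : ℂ) ^ (-ν + 1 / 2) * g u *
          widderTransform (fun x => (x : ℂ) ^ (ν - 1 / 2) * f x) u) := by

  refine ⟨fun h => ?_, integral_widder_symm ν f g⟩
  obtain ⟨hW, h1⟩ := integrableOn_widder_and_integral_hankel_mul_k hν f g h
  exact ⟨h1, h1.trans (integral_widder_symm ν f g hW)⟩
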